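/- Let $d,n,L\ge 1$, and for a function $\sigma:\mathbb R\to\mathbb R$ and a map $\Gamma$ sending sequences $(\mathbf u_1,\dots,\mathbf u_L)$ in $\mathbb R^d$ to sequences $(\mathbf y_1,\dots,\mathbf y_L)$ in $\mathbb R^d$, consider the single-layer model \[ \tilde G(u_1,\dots,u_L)=\mathbf N\,\sigma\bigl(\Gamma(\mathbf M u_1,\dots,\mathbf M u_L)_L+\boldsymbol\theta\bigr)=\sum_{i=1}^d N^{(i)}\,\sigma\bigl(\Gamma(\mathbf M u_1,\dots,\mathbf M u_L)_L^{(i)}+\theta^{(i)}\bigr), \] where $u_k\in\mathbb R$ and $\mathbf M,\mathbf N,\boldsymbol\theta\in\mathbb R^d$. Fix a step size $\Delta>0$, the same for all channels $i$ and all positions $k$, and put $\overline{\mathbf A}=\exp(\Delta\mathbf A)$. An S4D unit $\Gamma_{\mathrm{S4D}}$ with state size $n$ has parameters $\mathbf A\in\mathbb C^{n\times n}$ diagonal and invertible, and $\mathbf B^{(i)}\in\mathbb C^{n\times 1}$, $\mathbf C^{(i)}\in\mathbb C^{1\times n}$ for $1\le i\le d$, and is given by $\mathbf x^{(i)}_0=\mathbf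 0$ and \[ \mathbf x^{(i)}_k=\overline{\mathbf A}\,\mathbf x^{(i)}_{k-1}+\mathbf A^{-1}(\overline{\mathbf A}-\mathbf I)\mathbf B^{(i)}\,\mathbf u_k^{(i)},\qquad \mathbf y_k^{(i)}=\operatorname{Re}\bigl(\mathbf C^{(i)}\mathbf x^{(i)}_k\bigr). \] An S6 unit $\Gamma_{\mathrm{S6}}$ with state size $n$ has parameters $\mathbf A\in\mathbb R^{n\times n}$ invertible, $\mathbf B\in\mathbb R^{n\times d}$, $\mathbf C\in\mathbb R^{d\times n}$, and is given by $\mathbf x^{(i)}_0=\mathbf 0$ and \[ \mathbf x^{(i)}_k=\overline{\mathbf A}\,\mathbf x^{(i)}_{k-1}+\mathbf A^{-1}(\overline{\mathbf A}-\mathbf I)(\mathbf B\mathbf u_k)\,\mathbf u_k^{(i)},\qquad \mathbf y_k^{(i)}=(\mathbf u_k^\top\mathbf C)\,\mathbf x^{(i)}_k. \] Then the following two statements hold. 1. Let $L\ge 1$ and let $\sigma:\mathbb R\to\mathbb R$ be Lipschitz continuous and not a polynomial. For every continuous $G:[0,1]^L\to\mathbb R$ and every $\epsilon>0$ there exist $d\ge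 1$, $n\ge 1$ and parameters $\mathbf M,\mathbf N,\boldsymbol\theta,\mathbf A,\mathbf B^{(i)},\mathbf C^{(i)}$ such that the model $\tilde G$ with $\Gamma=\Gamma_{\mathrm{S4D}}$ satisfies $|\tilde G(\mathbf u)-G(\mathbf u)|\le\epsilon$ for all $\mathbf u\in[0,1]^L$. 2. Let $\sigma:\mathbb R\to\mathbb R$ be any function and let $L\ge 3$. There exist a continuous function $G:[0,1]^{L-1}\times\{1\}\to\mathbb R$ and an $\epsilon>0$ such that for all $d\ge 1$, all $n\ge 1$ and all parameters $\mathbf M,\mathbf N,\boldsymbol\theta,\mathbf A,\mathbf B,\mathbf C$, the model $\tilde G$ with $\Gamma=\Gamma_{\mathrm{S6}}$ satisfies $|\tilde G(\mathbf u)-G(\mathbf u)|>\epsilon$ for some $\mathbf u\in[0,1]^{L-1}\times\{1\}$. -/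

import Mathlib

open scoped Matrix

noncomputable section

namespace SSM

/-- Zero-order-hold discretization of the state matrix: `exp(Δ A)`. -/
def zohA {𝕜 : Type*} [RCLike 𝕜] {n : ℕ} (Δ : ℝ) (A : Matrix (Fin n) (Fin n) 𝕜) :
    Matrix (Fin n) (Fin n) 𝕜 :=
  NormedSpace.exp (Δ • A)

/-- Zero-order-hold discretization of an input vector `b`: `A⁻¹ (exp(Δ A) - I) b`. -/
def zohB {𝕜 : Type*} [RCLike 𝕜] {n : ℕ} (Δ : ℝ) (A : Matrix (Fin n) (Fin n) 𝕜)
    (b : Fin n → 𝕜) : Fin n → 𝕜 :=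
  (A⁻¹ * (zohA Δ A - 1)) *ᵥ b

/-- The hidden state `x_k` of channel `i` of an S4D unit, for `0 ≤ k ≤ L`, with `x_0 = 0`.
Positions of the sequence are indexed from `0`, so the `(k+1)`-st input is `u ⟨k, _⟩`. -/
def s4dState {L d n : ℕ} (Δ : Fin d → ℝ) (A : Matrix (Fin n) (Fin n) ℂ)
    (B : Fin d → Fin n → ℂ) (u : Fin L → Fin d → ℝ) (i : Fin d) :
    (k : ℕ) → k ≤ L → Fin n → ℂ
  | 0, _ => 0
  | k + 1, hk =>
      zohA (Δ i) A *ᵥ s4dState Δ A B u i k (Nat.le_of_succ_le hk)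
        + (u ⟨k, hk⟩ i : ℂ) • zohB (Δ i) A (B i)

/-- The S4D unit: `y_k^{(i)} = Re (C^{(i)} x_k^{(i)})`, with `Δ i`, `B i`, `C i` specific to
channel `i` and `A` shared by the channels. -/
def s4d {L d n : ℕ} (Δ : Fin d → ℝ) (A : Matrix (Fin n) (Fin n) ℂ)
    (B C : Fin d → Fin n → ℂ) (u : Fin L → Fin d → ℝ) : Fin L → Fin d → ℝ :=
  fun k i => (C i ⬝ᵥ s4dState Δ A B u i (k + 1) k.isLt).re

/-- The hidden state `x_k` of channel `i` of an S6 unit, for `0 ≤ k ≤ L`, with `x_0 = 0` and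
sampling interval `Δ k i` at position `k` in channel `i`. -/
def s6State {L d n : ℕ} (Δ : Fin L → Fin d → ℝ) (A : Matrix (Fin n) (Fin n) ℝ)
    (B : Matrix (Fin n) (Fin d) ℝ) (u : Fin L → Fin d → ℝ) (i : Fin d) :
    (k : ℕ) → k ≤ L → Fin n → ℝ
  | 0, _ => 0
  | k + 1, hk =>
      zohA (Δ ⟨k, hk⟩ i) A *ᵥ s6State Δ A B u i k (Nat.le_of_succ_le hk)
        + u ⟨k, hk⟩ i • zohB (Δ ⟨k, hk⟩ i) A (B *ᵥ u ⟨k, hk⟩)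

/-- The S6 unit: `y_k^{(i)} = (u_kᵀ C) x_k^{(i)}`, with `A`, `B`, `C` shared by the channels. -/
def s6 {L d n : ℕ} (Δ : Fin L → Fin d → ℝ) (A : Matrix (Fin n) (Fin n) ℝ)
    (B : Matrix (Fin n) (Fin d) ℝ) (C : Matrix (Fin d) (Fin n) ℝ)
    (u : Fin L → Fin d → ℝ) : Fin L → Fin d → ℝ :=
  fun k i => (u k ᵥ* C) ⬝ᵥ s6State Δ A B u i (k + 1) k.isLt

/-- The last position of a nonempty sequence. -/
def lastPos {L : ℕ} (hL : 0 < L) : Fin L := ⟨L - 1, Nat.sub_lt hL Nat.one_pos⟩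

/-- The single-layer model `u ↦ N σ(Γ(M u_1, …, M u_L)_L + θ)` with encoder `M`, decoder `N`,
bias `θ`, recurrent unit `Γ` and entrywise activation `σ`. -/
def oneLayer {L d : ℕ} (hL : 0 < L) (σ : ℝ → ℝ)
    (Γ : (Fin L → Fin d → ℝ) → Fin L → Fin d → ℝ) (M N θ : Fin d → ℝ)
    (u : Fin L → ℝ) : ℝ :=
  ∑ i, N i * σ (Γ (fun k j => M j * u k) (lastPos hL) i + θ i)

/-- The cube `[0,1]^L`. -/
def cube (L : ℕ) : Set (Fin L → ℝ) := {u | ∀ k, u k ∈ Set.Icc (0 : ℝ) 1}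

/-- The face `[0,1]^{L-1} × {1}` of the cube. -/
def face {L : ℕ} (hL : 0 < L) : Set (Fin L → ℝ) := {u | u ∈ cube L ∧ u (lastPos hL) = 1}

end SSM

end

/-!
Universality of S4D. Let `V` be the closed span of the neurons `x ↦ σ (ℓ x + b)` in `C(K, ℝ)`. It
contains the neurons of every mollification `f` of `σ`, and, differentiating `w ↦ f (w ℓ x + b)`
`k` times at `w = 0`, the functions `f⁽ᵏ⁾(b) ℓᵏ`. If some power `ℓᵏ` were missing from `V`, all
mollifications would be polynomials of degree less than `k`, and so would be their limit `σ`. Hence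
`V` contains all `exp ℓ = ∑ ℓᵏ / k!`; these are closed under multiplication and separate points, so
`V` is everything by Stone–Weierstrass. A diagonal S4D unit whose `L` eigenvalues have distinct
exponentials produces any linear form of its input, since its last state is the image of the input
under an invertible Vandermonde-type matrix.

Rigidity of S6. When the last input is fixed, all channels of the last S6 output are multiples of
one linear form `f` of the *squared* inputs. If `L ≥ 3`, moving the squared inputs along a direction
annihilated by `f` and fixing the last input does not change the model, so it cannot approximate the
distance of the squared inputs to a given point.
-/

namespace SSM

open Filter MeasureTheory Topology
open scoped Convolution ContDiff Polynomial

theorem hasDerivAt_continuousMap {𝕜 X E : Type*} [RCLike 𝕜] [TopologicalSpace X] [CompactSpace X]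
    [NormedAddCommGroup E] [NormedSpace 𝕜 E] {F F' : 𝕜 → C(X, E)} {t : 𝕜}
    (hF' : ContinuousAt F' t) (h : ∀ s x, HasDerivAt (fun r => F r x) (F' s x) s) :
    HasDerivAt F (F' t) t := by
  rw [hasDerivAt_iff_isLittleO, Asymptotics.isLittleO_iff]
  intro c hc
  obtain ⟨δ, hδ, hball⟩ := Metric.continuousAt_iff.1 hF' c hc
  filter_upwards [Metric.ball_mem_nhds t hδ] with s hs
  rw [ContinuousMap.norm_le _ (by positivity)]
  intro x
  have hderiv : ∀ r, HasDerivAt (fun r => F r x - r • F' t x) (F' r x - F' t x) r := fun r => by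
    simpa using (h r x).fun_sub ((hasDerivAt_id r).smul_const (F' t x))
  have hbound : ∀ r ∈ Metric.ball t δ, ‖F' r x - F' t x‖ ≤ c := fun r hr => by
    rw [← dist_eq_norm]
    exact (ContinuousMap.dist_apply_le_dist x).trans (hball hr).le
  have hmvt := (convex_ball t δ).norm_image_sub_le_of_norm_hasDerivWithin_le
    (fun r _ => (hderiv r).hasDerivWithinAt) hbound (Metric.mem_ball_self hδ) hs
  have hsplit : (F s - F t - (s - t) • F' t) x = F s x - s • F' t x - (F t x - t • F' t x) := by
    simp only [ContinuousMap.sub_apply, ContinuousMap.smul_apply, sub_smul]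
    abel
  rwa [hsplit]

section ClosedSubspace

variable {E : Type*} [NormedAddCommGroup E] [NormedSpace ℝ E] {V : Submodule ℝ E}

theorem hasDerivAt_mem_of_isClosed (hV : IsClosed (V : Set E)) {F : ℝ → E} {F' : E} {t : ℝ}
    (hF : HasDerivAt F F' t) (hFV : ∀ s, F s ∈ V) : F' ∈ V :=
  hV.mem_of_tendsto hF.tendsto_slope <| Eventually.of_forall fun s => by
    rw [slope_def_module]
    exact V.smul_mem _ (V.sub_mem (hFV s) (hFV t))

theorem integral_mem_of_isClosed [CompleteSpace E] (hV : IsClosed (V : Set E)) {α : Type*}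
    [MeasurableSpace α] {μ : Measure α} {F : α → E} (hF : Integrable F μ) (hFV : ∀ t, F t ∈ V) :
    ∫ t, F t ∂μ ∈ V := by
  have hquot : ∀ t, V.mkQL (F t) = 0 := fun t => (Submodule.Quotient.mk_eq_zero V).2 (hFV t)
  rw [← Submodule.Quotient.mk_eq_zero, ← Submodule.mkQ_apply, ← V.mkQL_apply,
    ← V.mkQL.integral_comp_comm hF]
  simp only [hquot, integral_zero]

end ClosedSubspace

theorem exp_mem_of_forall_pow_mem {𝔸 : Type*} [NormedRing 𝔸] [NormedAlgebra ℝ 𝔸]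
    {V : Submodule ℝ 𝔸} (hV : IsClosed (V : Set 𝔸)) {a : 𝔸} (ha : ∀ k : ℕ, a ^ k ∈ V) :
    NormedSpace.exp a ∈ V := by
  rw [NormedSpace.exp_eq_tsum ℝ]
  exact tsum_mem hV fun k => V.smul_mem _ (ha k)

theorem exists_polynomial_of_iteratedDeriv_eq_zero {f : ℝ → ℝ} {k : ℕ} (hf : ContDiff ℝ k f)
    (h : ∀ x, iteratedDeriv k f x = 0) :
    ∃ p ∈ Polynomial.degreeLT ℝ k, ∀ x, f x = p.eval x := by
  obtain - | n := k
  · exact ⟨0, zero_mem _, by simpa using h⟩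
  refine ⟨∑ i ∈ Finset.range (n + 1), Polynomial.monomial i (iteratedDeriv i f 0 / i.factorial),
    sum_mem fun i hi => Polynomial.mem_degreeLT.2 <|
      (Polynomial.degree_monomial_le _ _).trans_lt (mod_cast Finset.mem_range.1 hi), fun x => ?_⟩
  obtain rfl | hx := eq_or_ne 0 x
  · simp [Polynomial.eval_finsetSum, Finset.sum_range_succ']
  obtain ⟨y, -, hy⟩ := taylor_mean_remainder_lagrange_iteratedDeriv hx (n := n) hf.contDiffOn
  rw [h, zero_mul, zero_div, sub_eq_zero] at hy
  rw [hy, taylor_within_apply, Polynomial.eval_finsetSum]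
  refine Finset.sum_congr rfl fun i hi => ?_
  have hi : (i : WithTop ℕ∞) ≤ (n + 1 : ℕ) := mod_cast (Finset.mem_range.1 hi).le
  rw [iteratedDerivWithin_eq_iteratedDeriv (uniqueDiffOn_uIcc hx) (hf.of_le hi).contDiffAt
    Set.left_mem_uIcc, Polynomial.eval_monomial, smul_eq_mul, sub_zero]
  ring

theorem exists_polynomial_of_tendsto {𝕜 ι : Type*} [NontriviallyNormedField 𝕜] [CompleteSpace 𝕜]
    {l : Filter ι} [l.NeBot] {k : ℕ} {p : ι → 𝕜[X]} (hp : ∀ i, p i ∈ Polynomial.degreeLT 𝕜 k)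
    {f : 𝕜 → 𝕜} (hf : ∀ x, Tendsto (fun i => (p i).eval x) l (𝓝 (f x))) :
    ∃ q ∈ Polynomial.degreeLT 𝕜 k, ∀ x, f x = q.eval x := by
  let evalAll : 𝕜[X] →ₗ[𝕜] 𝕜 → 𝕜 := LinearMap.pi Polynomial.leval
  have : FiniteDimensional 𝕜 (Polynomial.degreeLT 𝕜 k) :=
    (Polynomial.degreeLTEquiv 𝕜 k).symm.finiteDimensional
  have hclosed := ((Polynomial.degreeLT 𝕜 k).map evalAll).closed_of_finiteDimensional
  obtain ⟨q, hq, hqf⟩ := hclosed.mem_of_tendsto (tendsto_pi_nhds.2 hf)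
    (Eventually.of_forall fun i => Submodule.mem_map_of_mem (hp i))
  exact ⟨q, hq, fun x => (congrFun hqf x).symm⟩

section Ridge

variable {X : Type*} [TopologicalSpace X]

/-- The ridge functions `x ↦ f (ℓ x + b)` with profile `f` along the directions `ℓ` of a space `W`
of continuous functions, that is, the neurons of a shallow network with activation `f`. -/
def ridgeFunctions (f : ℝ → ℝ) (W : Submodule ℝ C(X, ℝ)) : Set C(X, ℝ) :=
  {g | ∃ ℓ ∈ W, ∃ b : ℝ, ∀ x, g x = f (ℓ x + b)}

variable [CompactSpace X] {V W : Submodule ℝ C(X, ℝ)}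

theorem ridgeFunctions_convolution_subset (hV : IsClosed (V : Set C(X, ℝ))) {f φ : ℝ → ℝ}
    (hf : Continuous f) (hφ : Continuous φ) (hφc : HasCompactSupport φ)
    (hfV : ridgeFunctions f W ⊆ V) :
    ridgeFunctions (φ ⋆[ContinuousLinearMap.lsmul ℝ ℝ] f) W ⊆ V := by
  rintro g ⟨ℓ, hℓ, b, hg⟩
  let translate : ℝ → C(X, ℝ) := fun t => ⟨fun x => f (ℓ x + (b - t)), by fun_prop⟩
  have htranslate : Continuous translate := ContinuousMap.continuous_of_continuous_uncurry _ <| by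
    simp only [translate, Function.uncurry_def, ContinuousMap.coe_mk]
    fun_prop
  have hint : Integrable fun t => φ t • translate t :=
    (hφ.smul htranslate).integrable_of_hasCompactSupport hφc.smul_right
  have hg_eq : g = ∫ t, φ t • translate t := by
    ext x
    rw [hg, convolution_lsmul, ContinuousMap.integral_apply hint]
    simp only [translate, ContinuousMap.smul_apply, ContinuousMap.coe_mk, add_sub_assoc]
  rw [hg_eq]
  exact integral_mem_of_isClosed hV hint fun t =>
    V.smul_mem _ (hfV ⟨ℓ, hℓ, b - t, fun _ => rfl⟩)

theorem pow_mul_iteratedDeriv_mem (hV : IsClosed (V : Set C(X, ℝ))) {f : ℝ → ℝ}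
    (hf : ContDiff ℝ ∞ f) (hfV : ridgeFunctions f W ⊆ V) {ℓ : C(X, ℝ)} (hℓ : ℓ ∈ W) (k : ℕ)
    (w b : ℝ) {g : C(X, ℝ)} (hg : ∀ x, g x = ℓ x ^ k * iteratedDeriv k f (w * ℓ x + b)) :
    g ∈ V := by
  induction k generalizing w g with
  | zero => exact hfV ⟨w • ℓ, W.smul_mem w hℓ, b, by simpa using hg⟩
  | succ k ih =>
    have hcont : ∀ m, Continuous (iteratedDeriv m f) := fun m =>
      hf.continuous_iteratedDeriv m (mod_cast le_top)
    let F : ℕ → ℝ → C(X, ℝ) := fun m s =>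
      ⟨fun x => ℓ x ^ m * iteratedDeriv m f (s * ℓ x + b), by fun_prop⟩
    have hF : Continuous (F (k + 1)) := ContinuousMap.continuous_of_continuous_uncurry _ <| by
      simp only [F, Function.uncurry_def, ContinuousMap.coe_mk]
      fun_prop
    have hderiv : ∀ s x, HasDerivAt (fun r => F k r x) (F (k + 1) s x) s := fun s x => by
      have hinner : HasDerivAt (fun r => r * ℓ x + b) (ℓ x) s := by
        simpa using ((hasDerivAt_id s).mul_const (ℓ x)).add_const b
      have houter := (hf.differentiable_iteratedDeriv k (mod_cast WithTop.coe_lt_top _)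
        (s * ℓ x + b)).hasDerivAt
      rw [show F (k + 1) s x = ℓ x ^ k * (deriv (iteratedDeriv k f) (s * ℓ x + b) * ℓ x) by
        rw [← iteratedDeriv_succ, mul_comm _ (ℓ x), ← mul_assoc, ← pow_succ]; rfl]
      exact (houter.comp s hinner).const_mul (ℓ x ^ k)
    have hg_eq : g = F (k + 1) w := ContinuousMap.ext hg
    rw [hg_eq]
    exact hasDerivAt_mem_of_isClosed hV (hasDerivAt_continuousMap hF.continuousAt hderiv)
      fun s => ih s fun _ => rfl

theorem exists_polynomial_of_contDiff_of_pow_notMem (hV : IsClosed (V : Set C(X, ℝ))) {f : ℝ → ℝ}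
    (hf : ContDiff ℝ ∞ f) (hfV : ridgeFunctions f W ⊆ V) {ℓ : C(X, ℝ)} (hℓ : ℓ ∈ W) {k : ℕ}
    (hk : ℓ ^ k ∉ V) : ∃ p ∈ Polynomial.degreeLT ℝ k, ∀ x, f x = p.eval x := by
  refine exists_polynomial_of_iteratedDeriv_eq_zero (hf.of_le (mod_cast le_top)) fun b => ?_
  by_contra hb
  refine hk ((V.smul_mem_iff hb).1 (pow_mul_iteratedDeriv_mem hV hf hfV hℓ k 0 b fun x => ?_))
  simp [mul_comm]

theorem pow_mem_of_ridgeFunctions_subset (hV : IsClosed (V : Set C(X, ℝ))) {σ : ℝ → ℝ}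
    (hσ : Continuous σ) (hpoly : ¬ ∃ p : ℝ[X], ∀ x, σ x = p.eval x)
    (hσV : ridgeFunctions σ W ⊆ V) {ℓ : C(X, ℝ)} (hℓ : ℓ ∈ W) (k : ℕ) : ℓ ^ k ∈ V := by
  by_contra hk
  let φ : ℕ → ContDiffBump (0 : ℝ) := fun m =>
    ⟨1 / (m + 1) / 2, 1 / (m + 1), by positivity, half_lt_self (by positivity)⟩
  let mollify : ℕ → ℝ → ℝ := fun m =>
    (φ m).normed volume ⋆[ContinuousLinearMap.lsmul ℝ ℝ] σ
  have hlim : ∀ x, Tendsto (fun m => mollify m x) atTop (𝓝 (σ x)) :=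
    ContDiffBump.convolution_tendsto_right_of_continuous
      tendsto_one_div_add_atTop_nhds_zero_nat hσ
  have hsmooth : ∀ m, ContDiff ℝ ∞ (mollify m) := fun m =>
    (φ m).hasCompactSupport_normed.contDiff_convolution_left _ (φ m).contDiff_normed
      hσ.locallyIntegrable
  have hmem : ∀ m, ridgeFunctions (mollify m) W ⊆ V := fun m =>
    ridgeFunctions_convolution_subset hV hσ (φ m).continuous_normed
      (φ m).hasCompactSupport_normed hσV
  choose p hp hpσ using fun m =>
    exists_polynomial_of_contDiff_of_pow_notMem hV (hsmooth m) (hmem m) hℓ hk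
  simp only [hpσ] at hlim
  obtain ⟨q, -, hq⟩ := exists_polynomial_of_tendsto hp hlim
  exact hpoly ⟨q, hq⟩

theorem eq_top_of_submonoid_subset (hV : IsClosed (V : Set C(X, ℝ))) {S : Submonoid C(X, ℝ)}
    (hSV : (S : Set C(X, ℝ)) ⊆ V)
    (hS : ((fun f : C(X, ℝ) => (f : X → ℝ)) '' S).SeparatesPoints) : V = ⊤ := by
  have hadjoin : (Algebra.adjoin ℝ (S : Set C(X, ℝ)) : Set C(X, ℝ)) ⊆ V := by
    rw [← Subalgebra.coe_toSubmodule, Algebra.adjoin_eq_span, Submonoid.closure_eq]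
    exact Submodule.span_le.2 hSV
  have hsep : (Algebra.adjoin ℝ (S : Set C(X, ℝ))).SeparatesPoints := fun x y hxy =>
    let ⟨_, ⟨f, hf, hf_eq⟩, hne⟩ := hS hxy
    ⟨_, ⟨f, Algebra.subset_adjoin hf, hf_eq⟩, hne⟩
  have hdense := ContinuousMap.subalgebra_topologicalClosure_eq_top_of_separatesPoints _ hsep
  exact eq_top_iff.2 fun g _ => closure_minimal hadjoin hV (hdense.ge (Algebra.mem_top : g ∈ _))

theorem topologicalClosure_span_ridgeFunctions_eq_top {σ : ℝ → ℝ} (hσ : Continuous σ)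
    (hpoly : ¬ ∃ p : ℝ[X], ∀ x, σ x = p.eval x)
    (hW : ((fun f : C(X, ℝ) => (f : X → ℝ)) '' W).SeparatesPoints) :
    (Submodule.span ℝ (ridgeFunctions σ W)).topologicalClosure = ⊤ := by
  have hclosed := (Submodule.span ℝ (ridgeFunctions σ W)).isClosed_topologicalClosure
  let S : Submonoid C(X, ℝ) :=
    { carrier := NormedSpace.exp '' W
      one_mem' := ⟨0, W.zero_mem, NormedSpace.exp_zero⟩
      mul_mem' := by
        rintro _ _ ⟨ℓ, hℓ, rfl⟩ ⟨m, hm, rfl⟩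
        exact ⟨ℓ + m, W.add_mem hℓ hm, NormedSpace.exp_add⟩ }
  refine eq_top_of_submonoid_subset hclosed (S := S) ?_ fun x y hxy => ?_
  · rintro _ ⟨ℓ, hℓ, rfl⟩
    exact exp_mem_of_forall_pow_mem hclosed <| pow_mem_of_ridgeFunctions_subset hclosed hσ hpoly
      (Submodule.subset_span.trans (Submodule.le_topologicalClosure _)) hℓ
  · obtain ⟨_, ⟨ℓ, hℓ, rfl⟩, hne⟩ := hW hxy
    refine ⟨_, ⟨_, ⟨ℓ, hℓ, rfl⟩, rfl⟩, ?_⟩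
    have hexp : ∀ z, NormedSpace.exp ℓ z = Real.exp (ℓ z) := fun z => by
      rw [Real.exp_eq_exp_ℝ]
      exact NormedSpace.map_exp (ContinuousMap.evalAlgHom ℝ ℝ z)
        (ContinuousEvalConst.continuous_eval_const z) ℓ
    simpa only [hexp, ne_eq, Real.exp_eq_exp] using hne

end Ridge

theorem exists_sum_ridge_approx {E : Type*} [AddCommGroup E] [Module ℝ E] [TopologicalSpace E]
    [SeparatingDual ℝ E] {K : Set E} (hK : IsCompact K) {σ : ℝ → ℝ} (hσ : Continuous σ)
    (hpoly : ¬ ∃ p : ℝ[X], ∀ x, σ x = p.eval x) {G : E → ℝ} (hG : ContinuousOn G K) {ε : ℝ}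
    (hε : 0 < ε) :
    ∃ d : ℕ, 1 ≤ d ∧ ∃ (N θ : Fin d → ℝ) (f : Fin d → StrongDual ℝ E),
      ∀ u ∈ K, |∑ i, N i * σ (f i u + θ i) - G u| ≤ ε := by
  have : CompactSpace K := isCompact_iff_compactSpace.1 hK
  let restrict : StrongDual ℝ E →ₗ[ℝ] C(K, ℝ) :=
    { toFun := fun f => ⟨fun u => f u, by fun_prop⟩
      map_add' := fun _ _ => rfl
      map_smul' := fun _ _ => rfl }
  have hsep : ((fun g : C(K, ℝ) => (g : K → ℝ)) '' restrict.range).SeparatesPoints := by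
    intro u v huv
    obtain ⟨f, hf⟩ := SeparatingDual.exists_separating_of_ne (R := ℝ) (Subtype.coe_ne_coe.2 huv)
    exact ⟨_, ⟨restrict f, ⟨f, rfl⟩, rfl⟩, hf⟩
  have hdense := topologicalClosure_span_ridgeFunctions_eq_top hσ hpoly hsep
  obtain ⟨g, hg, hgG⟩ := Metric.mem_closure_iff.1
    (hdense.ge (Submodule.mem_top (x := ⟨K.domRestrict G, hG.domRestrict⟩))) ε hε
  obtain ⟨d, N, r, rfl⟩ := Submodule.mem_span_set'.1 hg
  choose ℓ hℓ θ hr using fun i => (r i).2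
  choose f hf using hℓ
  obtain rfl : (fun i => restrict (f i)) = ℓ := funext hf
  -- An extra neuron with zero weight ensures that there is at least one.
  refine ⟨d + 1, by omega, Fin.cons 0 N, Fin.cons 0 θ, Fin.cons 0 f, fun u hu => ?_⟩
  have hle := (ContinuousMap.dist_apply_le_dist ⟨u, hu⟩).trans hgG.le
  rw [dist_comm, Real.dist_eq] at hle
  simpa [hr, restrict, Fin.sum_univ_succ] using hle

section S4D

theorem zohA_diagonal {𝕜 : Type*} [RCLike 𝕜] {n : ℕ} (Δ : ℝ) (a : Fin n → 𝕜) :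
    zohA Δ (Matrix.diagonal a) = Matrix.diagonal fun j => NormedSpace.exp (Δ • a j) := by
  rw [zohA, ← Matrix.diagonal_smul, Matrix.exp_diagonal, Pi.exp_def]
  rfl

theorem zohB_diagonal_apply {𝕜 : Type*} [RCLike 𝕜] {n : ℕ} (Δ : ℝ) {a : Fin n → 𝕜}
    (ha : ∀ j, a j ≠ 0) (b : Fin n → 𝕜) (j : Fin n) :
    zohB Δ (Matrix.diagonal a) b j = (a j)⁻¹ * (NormedSpace.exp (Δ • a j) - 1) * b j := by
  have hinv : (Matrix.diagonal a)⁻¹ = Matrix.diagonal a⁻¹ :=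
    Matrix.inv_eq_left_inv <| by simp [Matrix.diagonal_mul_diagonal, ha]
  rw [zohB, zohA_diagonal, hinv, ← Matrix.diagonal_one, Matrix.diagonal_sub,
    Matrix.diagonal_mul_diagonal, Matrix.mulVec_diagonal, Pi.inv_apply]

theorem s4dState_eq_sum {L d n : ℕ} (Δ : Fin d → ℝ) (A : Matrix (Fin n) (Fin n) ℂ)
    (B : Fin d → Fin n → ℂ) (u : Fin L → Fin d → ℝ) (i : Fin d) (k : ℕ) (hk : k ≤ L) :
    s4dState Δ A B u i k hk =
      ∑ m : Fin k, (u (Fin.castLE hk m) i : ℂ) •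
        (zohA (Δ i) A ^ (m.rev : ℕ) *ᵥ zohB (Δ i) A (B i)) := by
  induction k with
  | zero => rfl
  | succ k ih =>
    simp only [s4dState, ih, Fin.sum_univ_castSucc, Fin.rev_castSucc, Fin.rev_last, Fin.val_succ,
      Fin.val_zero, pow_succ', pow_zero, Matrix.one_mulVec, Matrix.mulVec_sum, Matrix.mulVec_smul,
      Matrix.mulVec_mulVec]
    rfl

theorem s4dState_diagonal {L d n : ℕ} (Δ : Fin d → ℝ) (a : Fin n → ℂ) (B : Fin d → Fin n → ℂ)
    (u : Fin L → Fin d → ℝ) (i : Fin d) :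
    s4dState Δ (Matrix.diagonal a) B u i L le_rfl =
      (Matrix.diagonal (zohB (Δ i) (Matrix.diagonal a) (B i)) *
        Matrix.rectVandermonde 1 (fun j => NormedSpace.exp (Δ i • a j)) L) *ᵥ
          fun k => (u k i : ℂ) := by
  ext j
  rw [s4dState_eq_sum, zohA_diagonal, Finset.sum_apply]
  simp only [Matrix.diagonal_pow, Pi.smul_apply, Matrix.mulVec_diagonal]
  simp only [Matrix.mulVec, dotProduct, Matrix.diagonal_mul, Matrix.rectVandermonde_apply,
    Pi.pow_apply, Pi.one_apply, one_pow, one_mul, smul_eq_mul, Fin.castLE_rfl, id_eq]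
  exact Finset.sum_congr rfl fun m _ => by ring

theorem s4d_lastPos {L d n : ℕ} (hL : 0 < L) (Δ : Fin d → ℝ) (A : Matrix (Fin n) (Fin n) ℂ)
    (B C : Fin d → Fin n → ℂ) (u : Fin L → Fin d → ℝ) (i : Fin d) :
    s4d Δ A B C u (lastPos hL) i = (C i ⬝ᵥ s4dState Δ A B u i L le_rfl).re := by
  cases L with
  | zero => exact hL.false.elim
  | succ l => rfl

theorem exists_s4d_lastPos_eq_of_injective {L d : ℕ} (hL : 0 < L) {Δ : Fin d → ℝ} {a : Fin L → ℂ}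
    {B : Fin d → Fin L → ℂ} (hexp : ∀ i, Function.Injective fun j => NormedSpace.exp (Δ i • a j))
    (hB : ∀ i j, zohB (Δ i) (Matrix.diagonal a) (B i) j ≠ 0)
    (f : Fin d → (Fin L → ℝ) →ₗ[ℝ] ℝ) :
    ∃ C : Fin d → Fin L → ℂ, ∀ u i,
      s4d Δ (Matrix.diagonal a) B C u (lastPos hL) i = f i fun k => u k i := by
  let S : Fin d → Matrix (Fin L) (Fin L) ℂ := fun i =>
    Matrix.diagonal (zohB (Δ i) (Matrix.diagonal a) (B i)) *
      Matrix.projVandermonde 1 fun j => NormedSpace.exp (Δ i • a j)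
  have hS : ∀ i, IsUnit (S i).det := fun i => by
    rw [isUnit_iff_ne_zero, Matrix.det_mul, Matrix.det_diagonal, Matrix.det_projVandermonde]
    refine mul_ne_zero (Finset.prod_ne_zero_iff.2 fun j _ => hB i j) ?_
    simp only [Finset.prod_ne_zero_iff, Pi.one_apply, one_mul, sub_ne_zero]
    exact fun j _ m hm => (hexp i).ne (Finset.mem_Ioi.1 hm).ne
  have hstate : ∀ u i,
      s4dState Δ (Matrix.diagonal a) B u i L le_rfl = S i *ᵥ fun k => (u k i : ℂ) :=
    fun u i => s4dState_diagonal Δ a B u i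
  let w : Fin d → Fin L → ℂ := fun i m => (f i fun k => if m = k then 1 else 0 : ℝ)
  refine ⟨fun i => w i ᵥ* (S i)⁻¹, fun u i => ?_⟩
  rw [s4d_lastPos, hstate, Matrix.dotProduct_mulVec, Matrix.vecMul_vecMul,
    Matrix.nonsing_inv_mul _ (hS i), Matrix.vecMul_one, LinearMap.pi_apply_eq_sum_univ (f i)]
  simp [w, dotProduct, mul_comm]

theorem exists_s4d_lastPos_eq {L d : ℕ} (hL : 0 < L) {Δ : Fin d → ℝ} (hΔ : ∀ i, Δ i ≠ 0)
    (f : Fin d → (Fin L → ℝ) →ₗ[ℝ] ℝ) :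
    ∃ (A : Matrix (Fin L) (Fin L) ℂ) (B C : Fin d → Fin L → ℂ), A.IsDiag ∧ IsUnit A.det ∧
      ∀ u i, s4d Δ A B C u (lastPos hL) i = f i fun k => u k i := by
  let a : Fin L → ℝ := fun j => j + 1
  have ha : ∀ j, a j ≠ 0 := fun j => j.val.cast_add_one_ne_zero
  have hexp : ∀ i j, NormedSpace.exp (Δ i • (a j : ℂ)) = (Real.exp (Δ i * a j) : ℂ) := fun i j => by
    rw [Complex.real_smul, ← Complex.exp_eq_exp_ℂ, Complex.ofReal_exp, Complex.ofReal_mul]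
  have hinj : ∀ i, Function.Injective fun j => NormedSpace.exp (Δ i • (a j : ℂ)) :=
    fun i j m hjm => by
      simp only [hexp, Complex.ofReal_inj, Real.exp_eq_exp] at hjm
      exact Fin.ext (Nat.cast_injective (add_right_cancel (mul_left_cancel₀ (hΔ i) hjm)))
  have hB : ∀ i j, zohB (Δ i) (Matrix.diagonal fun j => (a j : ℂ)) 1 j ≠ 0 := fun i j => by
    rw [zohB_diagonal_apply _ fun j => Complex.ofReal_ne_zero.2 (ha j), hexp, Pi.one_apply, mul_one]
    refine mul_ne_zero (inv_ne_zero (Complex.ofReal_ne_zero.2 (ha j))) (sub_ne_zero.2 ?_)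
    exact mod_cast Real.exp_eq_one_iff _ |>.not.2 (mul_ne_zero (hΔ i) (ha j))
  obtain ⟨C, hC⟩ := exists_s4d_lastPos_eq_of_injective hL hinj hB f
  refine ⟨_, _, C, Matrix.isDiag_diagonal _, ?_, hC⟩
  rw [Matrix.det_diagonal, isUnit_iff_ne_zero, Finset.prod_ne_zero_iff]
  exact fun j _ => Complex.ofReal_ne_zero.2 (ha j)

end S4D

section S6

theorem exists_s6State_eq_smul {L d n : ℕ} (Δ : Fin L → ℝ) (A : Matrix (Fin n) (Fin n) ℝ)
    (B : Matrix (Fin n) (Fin d) ℝ) (M : Fin d → ℝ) (k : ℕ) (hk : k ≤ L) :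
    ∃ T : (Fin L → ℝ) →ₗ[ℝ] Fin n → ℝ, ∀ v i,
      s6State (fun k _ => Δ k) A B (fun k j => M j * v k) i k hk = M i • T (v ^ 2) := by
  induction k with
  | zero => exact ⟨0, fun v i => by simp [s6State]⟩
  | succ k ih =>
    obtain ⟨T, hT⟩ := ih (Nat.le_of_succ_le hk)
    let z : Fin n → ℝ := zohB (Δ ⟨k, hk⟩) A (B *ᵥ M)
    have hzohB : ∀ c : ℝ, zohB (Δ ⟨k, hk⟩) A (B *ᵥ fun j => M j * c) = c • z := fun c => by
      rw [show (fun j => M j * c) = c • M from funext fun j => mul_comm _ _, zohB,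
        Matrix.mulVec_smul, Matrix.mulVec_smul, ← zohB]
    refine ⟨(zohA (Δ ⟨k, hk⟩) A).mulVecLin ∘ₗ T + (LinearMap.proj ⟨k, hk⟩).smulRight z,
      fun v i => ?_⟩
    simp only [s6State, hT, hzohB, Matrix.mulVec_smul, LinearMap.add_apply, LinearMap.comp_apply,
      Matrix.mulVecLin_apply, LinearMap.smulRight_apply, LinearMap.proj_apply, Pi.pow_apply,
      smul_add, smul_smul]
    ring_nf

theorem exists_s6_eq_mul {L d n : ℕ} (Δ : Fin L → ℝ) (A : Matrix (Fin n) (Fin n) ℝ)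
    (B : Matrix (Fin n) (Fin d) ℝ) (C : Matrix (Fin d) (Fin n) ℝ) (M : Fin d → ℝ) (k : Fin L) :
    ∃ f : (Fin L → ℝ) →ₗ[ℝ] ℝ, ∀ v i,
      s6 (fun k _ => Δ k) A B C (fun k j => M j * v k) k i = M i * (v k * f (v ^ 2)) := by
  obtain ⟨T, hT⟩ := exists_s6State_eq_smul Δ A B M (k + 1) k.isLt
  refine ⟨dotProductBilin ℝ ℝ (M ᵥ* C) ∘ₗ T, fun v i => ?_⟩
  rw [s6, hT, show (fun j => M j * v k) = v k • M from funext fun j => mul_comm _ _,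
    Matrix.smul_vecMul, smul_dotProduct, dotProduct_smul]
  simp only [smul_eq_mul, LinearMap.comp_apply]
  exact mul_left_comm _ _ _

theorem exists_norm_eq_one_map_eq_zero {E F : Type*} [NormedAddCommGroup E] [NormedSpace ℝ E]
    [FiniteDimensional ℝ E] [AddCommGroup F] [Module ℝ F] [FiniteDimensional ℝ F]
    (h : Module.finrank ℝ F < Module.finrank ℝ E) (f : E →ₗ[ℝ] F) :
    ∃ x, ‖x‖ = 1 ∧ f x = 0 := by
  obtain ⟨x, hx, hx0⟩ := Submodule.ne_bot_iff _ |>.1 (f.ker_ne_bot_of_finrank_lt h)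
  exact ⟨‖x‖⁻¹ • x, norm_smul_inv_norm hx0, by rw [map_smul, LinearMap.mem_ker.1 hx, smul_zero]⟩

theorem exists_oneLayer_s6_eq_of_map_sq_eq {L : ℕ} (hL : 0 < L) (σ : ℝ → ℝ) (Δ : Fin L → ℝ)
    {d n : ℕ} (A : Matrix (Fin n) (Fin n) ℝ) (B : Matrix (Fin n) (Fin d) ℝ)
    (C : Matrix (Fin d) (Fin n) ℝ) (M N θ : Fin d → ℝ) :
    ∃ f : (Fin L → ℝ) →ₗ[ℝ] ℝ, ∀ u v, u (lastPos hL) = v (lastPos hL) → f (u ^ 2) = f (v ^ 2) →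
      oneLayer hL σ (s6 (fun k _ => Δ k) A B C) M N θ u =
        oneLayer hL σ (s6 (fun k _ => Δ k) A B C) M N θ v := by
  obtain ⟨f, hf⟩ := exists_s6_eq_mul Δ A B C M (lastPos hL)
  exact ⟨f, fun u v hlast hfuv => by simp only [oneLayer, hf, hlast, hfuv]⟩

/-- The midpoint `(1/2, …, 1/2, 1)` of the face `[0,1]^{L-1} × {1}`, around which the S6 model is
too rigid. Its entries are rational and its entrywise square is still interior to the face. -/
noncomputable def faceMidpoint {L : ℕ} (hL : 0 < L) : Fin L → ℝ :=
  Function.update (fun _ => 1 / 2) (lastPos hL) 1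

theorem faceMidpoint_mem_face {L : ℕ} (hL : 0 < L) : faceMidpoint hL ∈ face hL := by
  refine ⟨fun k => ?_, Function.update_self ..⟩
  rw [faceMidpoint, Function.update_apply]
  split_ifs <;> norm_num

theorem sqrt_mem_face {L : ℕ} {hL : 0 < L} {x : Fin L → ℝ} (hx : x ∈ face hL) :
    (fun k => √(x k)) ∈ face hL :=
  ⟨fun k => ⟨Real.sqrt_nonneg _, Real.sqrt_le_one.2 (hx.1 k).2⟩, by simp only [hx.2, Real.sqrt_one]⟩

theorem faceMidpoint_sq_add_smul_mem_face {L : ℕ} {hL : 0 < L} {s : Fin L → ℝ} (hs : ‖s‖ ≤ 1)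
    (hs_last : s (lastPos hL) = 0) : faceMidpoint hL ^ 2 + (1 / 4 : ℝ) • s ∈ face hL := by
  have hlast : (faceMidpoint hL ^ 2 + (1 / 4 : ℝ) • s) (lastPos hL) = 1 := by
    simp [faceMidpoint, hs_last]
  refine ⟨fun k => ?_, hlast⟩
  obtain rfl | hk := eq_or_ne k (lastPos hL)
  · simp only [hlast, Set.right_mem_Icc, zero_le_one]
  have hsk := abs_le.1 ((norm_le_pi_norm s k).trans hs)
  simp only [faceMidpoint, Pi.add_apply, Pi.pow_apply, Pi.smul_apply, Function.update_of_ne hk,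
    smul_eq_mul]
  constructor <;> linarith

theorem exists_mem_face_map_sq_eq {L : ℕ} (hL : 3 ≤ L) (f : (Fin L → ℝ) →ₗ[ℝ] ℝ) :
    ∃ u ∈ face (Nat.zero_lt_of_lt hL), f (u ^ 2) = f (faceMidpoint (Nat.zero_lt_of_lt hL) ^ 2) ∧
      ‖u ^ 2 - faceMidpoint (Nat.zero_lt_of_lt hL) ^ 2‖ = 1 / 4 := by
  let c := faceMidpoint (Nat.zero_lt_of_lt hL)
  let last : (Fin L → ℝ) →ₗ[ℝ] ℝ := LinearMap.proj (lastPos (Nat.zero_lt_of_lt hL))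
  obtain ⟨s, hs, hs_ker⟩ := exists_norm_eq_one_map_eq_zero
    (by simpa using Nat.lt_of_succ_le hL) (f.prod last)
  obtain ⟨hfs, hs_last⟩ : f s = 0 ∧ last s = 0 := Prod.ext_iff.1 hs_ker
  have hmem := faceMidpoint_sq_add_smul_mem_face hs.le hs_last
  have hsq : (fun k => √((c ^ 2 + (1 / 4 : ℝ) • s) k)) ^ 2 = c ^ 2 + (1 / 4 : ℝ) • s :=
    funext fun k => Real.sq_sqrt (hmem.1 k).1
  refine ⟨_, sqrt_mem_face hmem, ?_, ?_⟩
  · rw [hsq, map_add, map_smul, hfs, smul_zero, add_zero]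
  · rw [hsq, add_sub_cancel_left, norm_smul, hs, mul_one, Real.norm_of_nonneg (by norm_num)]

theorem exists_continuous_forall_s6_not_approx {L : ℕ} (hL : 3 ≤ L) :
    ∃ G : (Fin L → ℝ) → ℝ, Continuous G ∧
      ∃ ε : ℝ, 0 < ε ∧ ∀ (σ : ℝ → ℝ) (Δ : Fin L → ℝ) (d n : ℕ) (M N θ : Fin d → ℝ)
        (A : Matrix (Fin n) (Fin n) ℝ) (B : Matrix (Fin n) (Fin d) ℝ)
        (C : Matrix (Fin d) (Fin n) ℝ), ∃ u ∈ face (Nat.zero_lt_of_lt hL),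
          ε < |oneLayer (Nat.zero_lt_of_lt hL) σ (s6 (fun k _ => Δ k) A B C) M N θ u - G u| := by
  let c := faceMidpoint (Nat.zero_lt_of_lt hL)
  refine ⟨fun u => ‖u ^ 2 - c ^ 2‖, by fun_prop, 1 / 9, by norm_num,
    fun σ Δ d n M N θ A B C => ?_⟩
  obtain ⟨f, hf⟩ :=
    exists_oneLayer_s6_eq_of_map_sq_eq (Nat.zero_lt_of_lt hL) σ Δ A B C M N θ
  obtain ⟨u, hu, hfu, hdist⟩ := exists_mem_face_map_sq_eq hL f
  have hc := faceMidpoint_mem_face (Nat.zero_lt_of_lt hL)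
  have heq := hf u c (hu.2.trans hc.2.symm) hfu
  by_contra! happrox
  have hu_err := abs_le.1 (happrox u hu)
  have hc_err := abs_le.1 (happrox c hc)
  rw [heq, hdist] at hu_err
  rw [sub_self, norm_zero] at hc_err
  linarith

end S6

theorem isCompact_cube (L : ℕ) : IsCompact (cube L) := by
  have hcube : cube L = Set.Icc 0 1 := Set.ext fun _ => forall_and
  exact hcube ▸ isCompact_Icc

theorem exists_oneLayer_s4d_approx {Δ : ℝ} (hΔ : Δ ≠ 0) {L : ℕ} (hL : 0 < L) {σ : ℝ → ℝ}
    (hσ : Continuous σ) (hpoly : ¬ ∃ p : ℝ[X], ∀ x, σ x = p.eval x) {K : Set (Fin L → ℝ)}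
    (hK : IsCompact K) {G : (Fin L → ℝ) → ℝ} (hG : ContinuousOn G K) {ε : ℝ} (hε : 0 < ε) :
    ∃ d n : ℕ, 1 ≤ d ∧ 1 ≤ n ∧
      ∃ (M N θ : Fin d → ℝ) (A : Matrix (Fin n) (Fin n) ℂ) (B C : Fin d → Fin n → ℂ),
        A.IsDiag ∧ IsUnit A.det ∧
        ∀ u ∈ K, |oneLayer hL σ (s4d (fun _ => Δ) A B C) M N θ u - G u| ≤ ε := by
  obtain ⟨d, hd, N, θ, f, happrox⟩ := exists_sum_ridge_approx hK hσ hpoly hG hε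
  obtain ⟨A, B, C, hA, hdet, hs4d⟩ :=
    exists_s4d_lastPos_eq hL (fun _ => hΔ) fun i => (f i : (Fin L → ℝ) →ₗ[ℝ] ℝ)
  refine ⟨d, L, hd, hL, 1, N, θ, A, B, C, hA, hdet, fun u hu => ?_⟩
  simpa only [oneLayer, hs4d, Pi.one_apply, one_mul, ContinuousLinearMap.coe_coe] using happrox u hu

end SSM

theorem mainTheorem1_general :
    (∀ Δ : ℝ, Δ ≠ 0 → ∀ (L : ℕ) (hL : 0 < L) (σ : ℝ → ℝ), Continuous σ →
      (¬ ∃ p : Polynomial ℝ, ∀ x, σ x = p.eval x) →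
      ∀ K : Set (Fin L → ℝ), IsCompact K →
      ∀ G : (Fin L → ℝ) → ℝ, ContinuousOn G K →
      ∀ ε : ℝ, 0 < ε →
      ∃ d n : ℕ, 1 ≤ d ∧ 1 ≤ n ∧
        ∃ (M N θ : Fin d → ℝ) (A : Matrix (Fin n) (Fin n) ℂ) (B C : Fin d → Fin n → ℂ),
          A.IsDiag ∧ IsUnit A.det ∧
          ∀ u ∈ K, |SSM.oneLayer hL σ (SSM.s4d (fun _ => Δ) A B C) M N θ u - G u| ≤ ε) ∧
    (∀ (L : ℕ) (hL : 3 ≤ L),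
      ∃ G : (Fin L → ℝ) → ℝ, Continuous G ∧
      ∃ ε : ℝ, 0 < ε ∧
      ∀ (σ : ℝ → ℝ) (Δ : Fin L → ℝ) (d n : ℕ) (M N θ : Fin d → ℝ)
        (A : Matrix (Fin n) (Fin n) ℝ) (B : Matrix (Fin n) (Fin d) ℝ)
        (C : Matrix (Fin d) (Fin n) ℝ),
        ∃ u ∈ SSM.face (Nat.zero_lt_of_lt hL),
          ε < |SSM.oneLayer (Nat.zero_lt_of_lt hL) σ (SSM.s6 (fun k _ => Δ k) A B C) M N θ u
                - G u|) :=
  ⟨fun _ hΔ _ hL _ hσ hpoly _ hK _ hG _ hε =>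
      SSM.exists_oneLayer_s4d_approx hΔ hL hσ hpoly hK hG hε,
    fun _ hL => SSM.exists_continuous_forall_s6_not_approx hL⟩

theorem mainTheorem1 (Δ : ℝ) (hΔ : 0 < Δ) :
    (∀ (L : ℕ) (hL : 0 < L) (σ : ℝ → ℝ),
      (∃ K : NNReal, LipschitzWith K σ) →
      (¬ ∃ p : Polynomial ℝ, ∀ x, σ x = p.eval x) →
      ∀ G : (Fin L → ℝ) → ℝ, ContinuousOn G (SSM.cube L) →
      ∀ ε : ℝ, 0 < ε →
      ∃ d n : ℕ, 1 ≤ d ∧ 1 ≤ n ∧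
        ∃ (M N θ : Fin d → ℝ) (A : Matrix (Fin n) (Fin n) ℂ) (B C : Fin d → Fin n → ℂ),
          A.IsDiag ∧ IsUnit A.det ∧
          ∀ u ∈ SSM.cube L,
            |SSM.oneLayer hL σ (SSM.s4d (fun _ => Δ) A B C) M N θ u - G u| ≤ ε) ∧
    (∀ (σ : ℝ → ℝ) (L : ℕ) (hL : 3 ≤ L),
      ∃ G : (Fin L → ℝ) → ℝ, ContinuousOn G (SSM.face (Nat.zero_lt_of_lt hL)) ∧
      ∃ ε : ℝ, 0 < ε ∧
      ∀ d n : ℕ, 1 ≤ d → 1 ≤ n →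
        ∀ (M N θ : Fin d → ℝ) (A : Matrix (Fin n) (Fin n) ℝ) (B : Matrix (Fin n) (Fin d) ℝ)
          (C : Matrix (Fin d) (Fin n) ℝ),
          ∃ u ∈ SSM.face (Nat.zero_lt_of_lt hL),
            ε < |SSM.oneLayer (Nat.zero_lt_of_lt hL) σ (SSM.s6 (fun _ _ => Δ) A B C) M N θ u
                  - G u|) := by
  obtain ⟨hs4d, hs6⟩ := mainTheorem1_general
  refine ⟨fun L hL σ ⟨_, hσ⟩ hpoly =>
    hs4d Δ hΔ.ne' L hL σ hσ.continuous hpoly _ (SSM.isCompact_cube L), fun σ L hL => ?_⟩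
  obtain ⟨G, hG, ε, hε, hnot⟩ := hs6 L hL
  exact ⟨G, hG.continuousOn, ε, hε, fun d n _ _ => hnot σ (fun _ => Δ) d n⟩
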